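/- Notation: $[n]=\{1,\dots,n\}$; $\binom{[n]}{k}$ is the family of all $k$-element subsets of $[n]$; $\overline{\mathcal F}=\{[n]\setminus F: F\in\mathcal F\}$ for a family $\mathcal F$ of subsets of $[n]$. Families $\mathcal F_1,\dots,\mathcal F_r$ of subsets of $[n]$ are cross-intersecting if $F_i\cap F_j\neq\emptyset$ for all $1\le i<j\le r$, $F_i\in\mathcal F_i$, $F_j\in\mathcal F_j$; a family $\mathcal F$ is intersecting if $A\cap B\ne\emptyset$ for all $A,B\in\mathcal F$. **Theorem.** Let $r\ge 2$ and let $n,k_1,\dots,k_r$ be positive integers. Let $\mathcal F_1\subseteq\binom{[n]}{k_1},\dots,\mathcal F_r\subseteq\binom{[n]}{k_r}$ be non-empty cross-intersecting families, and let $i^*\in[r]$ be such that $|\mathcal F_{i^*}|\ge\binom{n-1}{k_{i^*}-1}$. Put $\bar k=\min\{k_i: i\in[r],\ i\ne i^*\}$ and assume $n\ge k_i+k_{i^*}$ for every $i\ne i^*$. Put $$M_{\bar k}=\binom{n}{k_{i^*}}-\binom{n-\bar k}{k_{i^*}}+\sum_{i\ne i^*}\binom{n-\bar k}{k_i-\bar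 k},\qquad M_1=\sum_{i=1}^r\binom{n-1}{k_i-1}.$$ Then $$\sum_{i=1}^r|\mathcal F_i|\le\max\{M_{\bar k},M_1\}.$$ Moreover, equality holds if and only if the condition below that applies is satisfied. 1. Suppose $n=\bar k+k_{i^*}$ (so that $k_i=\bar k$ for all $i\ne i^*$). - (i) If $r=2$ and $j$ is the index other than $i^*$: $\mathcal F_{i^*}=\binom{[n]}{k_{i^*}}\setminus\overline{\mathcal F_j}$ and $1\le|\mathcal F_j|\le\binom{n-1}{\bar k-1}$. - (ii) If $r>2$ and $n>2\bar k$: there is $x\in[n]$ such that $\mathcal F_{i^*}=\{F\in\binom{[n]}{k_{i^*}}: x\in F\}$ and $\mathcal F_i=\{F\in\binom{[n]}{\bar k}: x\in F\}$ for every $i\ne i^*$. - (iii) If $r>2$ and $n\le 2\bar k$: there is an intersecting family $\mathcal F\subseteq\binom{[n]}{\bar k}$ with $|\mathcal F|=\binom{n-1}{\bar k-1}$ such that $\mathcal F_i=\mathcal F$ for every $i\ne i^*$ and $\mathcal F_{i^*}=\binom{[n]}{k_{i^*}}\setminus\overline{\mathcal F}$. 2. Suppose $n>\bar k+k_{i^*}$: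 there is a set $S\subseteq[n]$ such that either $|S|=1$ and $M_1\ge M_{\bar k}$, or $|S|=\bar k$ and $M_{\bar k}\ge M_1$, and such that $\mathcal F_{i^*}=\{F\in\binom{[n]}{k_{i^*}}: F\cap S\ne\emptyset\}$ and $\mathcal F_i=\{F\in\binom{[n]}{k_i}: S\subseteq F\}$ for every $i\ne i^*$. -/

import Mathlib

/-- The families `F₁, …, F_r` of subsets of `[n]` are cross-intersecting: any member of one of them
meets any member of any other one of them. (The ground set `[n]` is `Fin n`, the index set `[r]`
is `Fin r`.) -/
def CrossIntersecting {n r : ℕ} (F : Fin r → Finset (Finset (Fin n))) : Prop :=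
  ∀ i j : Fin r, i < j → ∀ A ∈ F i, ∀ B ∈ F j, (A ∩ B).Nonempty

/-- The family `C([n], k)` of all `k`-element subsets of `[n]`. -/
def kSubsets (n k : ℕ) : Finset (Finset (Fin n)) :=
  Finset.powersetCard k Finset.univ

/-- The family of the complements `[n] \ F` of the members `F` of a family `𝓕`. -/
def complFamily {n : ℕ} (𝓕 : Finset (Finset (Fin n))) : Finset (Finset (Fin n)) :=
  𝓕.image (fun A => Finset.univ \ A)

/-- `C(n,k_{i*}) - C(n-k̄,k_{i*}) + ∑_{i ≠ i*} C(n-k̄,k_i-k̄)`. When `k̄` is the least of the `k_i`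
with `i ≠ i*` and `k̄ ≤ n`, no subtraction is truncated. -/
def boundMin {r : ℕ} (n : ℕ) (k : Fin r → ℕ) (istar : Fin r) (kbar : ℕ) : ℕ :=
  (n.choose (k istar) - (n - kbar).choose (k istar)) +
    ∑ i ∈ Finset.univ.erase istar, (n - kbar).choose (k i - kbar)

/-- `∑ C(n-1,k_i-1)`, the sum over all `i ∈ [r]`. -/
def boundOne {r : ℕ} (n : ℕ) (k : Fin r → ℕ) : ℕ :=
  ∑ i, (n - 1).choose (k i - 1)

/-! Write `a = k istar` and `|F istar| = C(n-1,a-1) + x`. A set meets every member of `F istar`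
exactly when it lies in no complement of a member, so `F i` avoids the `k i`-level shadow of these
complements. By Kruskal–Katona (`exists_split`), the complements may be replaced, without enlarging
their shadows, by all `(n-a)`-sets missing one point together with `x` sets through it. If `Y` is
the link of that point, then `|F i| ≤ C(n-1,k i-1) - |∂Y|`, with `∂Y` the shadow of `Y` at level `k
i - 1`.

A member of an `F j` with `k j = kbar` forces `x ≤ X`, where `X` is the value of `x` for the family
of all `a`-sets meeting a fixed `kbar`-set. On this range `card_mul_avoidCount_le_and_lt` bounds
`|∂Y| / x` below by the ratio belonging to `X`. The total is therefore at most an affine function of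
`x` equal to `boundOne` at `0` and to `boundMin` at `X`, hence at most their maximum.

If `n > kbar + a`, the ratio bound is strict at `j` for `0 < x < X`, so equality needs an endpoint.
At `x = X` the family `F j` is a single set, which determines everything. At `x = 0` both `F istar`
and `F j` have the size of a star, and uniqueness in Kruskal–Katona (`exists_forall_notMem`, by
counting degrees) yields a common point. If `n = kbar + a`, cross-intersection only forbids
complementary pairs, and the sizes are compared directly. -/

namespace CrossIntersecting

open Finset
open scoped FinsetFamily

/-! ### Shadows at a given level -/

/-- The `c`-element sets that are contained in some member of the family `𝒜`. -/
def levelShadow {α : Type*} [Fintype α] [DecidableEq α] (c : ℕ) (𝒜 : Finset (Finset α)) :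
    Finset (Finset α) :=
  {S | S.card = c ∧ ∃ T ∈ 𝒜, S ⊆ T}

section levelShadow

variable {α : Type*} [Fintype α] [DecidableEq α] {𝒜 : Finset (Finset α)} {S : Finset α} {c r : ℕ}

lemma mem_levelShadow : S ∈ levelShadow c 𝒜 ↔ S.card = c ∧ ∃ T ∈ 𝒜, S ⊆ T := by
  simp [levelShadow]

lemma levelShadow_sized : (levelShadow c 𝒜 : Set (Finset α)).Sized c := fun _ hS =>
  (mem_levelShadow.1 hS).1

lemma levelShadow_levelShadow_subset {d : ℕ} :
    levelShadow c (levelShadow d 𝒜) ⊆ levelShadow c 𝒜 := by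
  intro S hS
  rw [mem_levelShadow] at *
  obtain ⟨h1, T, hT, h2⟩ := hS
  obtain ⟨-, U, hU, h3⟩ := mem_levelShadow.1 hT
  exact ⟨h1, U, hU, h2.trans h3⟩

lemma levelShadow_eq_iterate (h𝒜 : (𝒜 : Set (Finset α)).Sized r) (hc : c ≤ r) :
    levelShadow c 𝒜 = ∂^[r - c] 𝒜 := by
  ext S
  rw [mem_levelShadow, mem_shadow_iterate_iff_exists_mem_card_add]
  constructor
  · rintro ⟨h1, T, hT, h2⟩
    exact ⟨T, hT, h2, by rw [h𝒜 hT, h1]; omega⟩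
  · rintro ⟨T, hT, h2, h3⟩
    rw [h𝒜 hT] at h3
    exact ⟨by omega, T, hT, h2⟩

lemma levelShadow_powersetCard (hc : c ≤ r) (hr : r ≤ Fintype.card α) :
    levelShadow c (powersetCard r (univ : Finset α)) = powersetCard c univ := by
  ext S
  simp only [mem_levelShadow, mem_powersetCard, subset_univ, true_and, and_iff_left_iff_imp]
  intro hS
  obtain ⟨T, h1, -, h2⟩ := exists_subsuperset_card_eq (subset_univ S) (hS.le.trans hc)
    (by simpa using hr)
  exact ⟨T, h2, h1⟩

lemma card_levelShadow_of_full (hc : c ≤ r) (hr : r ≤ Fintype.card α)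
    (h : (𝒜 : Set (Finset α)).Sized r) (hcard : 𝒜.card = (Fintype.card α).choose r) :
    (levelShadow c 𝒜).card = (Fintype.card α).choose c := by
  have : 𝒜 = powersetCard r univ := by
    refine eq_of_subset_of_card_le (fun S hS => ?_) ?_
    · simpa using h hS
    · simp [hcard]
  rw [this, levelShadow_powersetCard hc hr]
  simp

end levelShadow

/-! ### Deletion and link of a point -/

section link

variable {N : ℕ} {𝒜 : Finset (Finset (Fin (N + 1)))} {v : Fin (N + 1)} {S : Finset (Fin N)}

/-- The members of `𝒜` that avoid `v`, as sets of the ground set without `v`. -/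
def del (v : Fin (N + 1)) (𝒜 : Finset (Finset (Fin (N + 1)))) : Finset (Finset (Fin N)) :=
  {S | S.map v.succAboveEmb ∈ 𝒜}

/-- The members of `𝒜` that contain `v`, with `v` removed. -/
def link (v : Fin (N + 1)) (𝒜 : Finset (Finset (Fin (N + 1)))) : Finset (Finset (Fin N)) :=
  {S | insert v (S.map v.succAboveEmb) ∈ 𝒜}

lemma mem_del : S ∈ del v 𝒜 ↔ S.map v.succAboveEmb ∈ 𝒜 := by simp [del]

lemma mem_link : S ∈ link v 𝒜 ↔ insert v (S.map v.succAboveEmb) ∈ 𝒜 := by simp [link]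

lemma notMem_map_succAbove : v ∉ S.map v.succAboveEmb := by
  simp [Fin.succAbove_ne]

lemma exists_map_succAbove (T : Finset (Fin (N + 1))) :
    ∃ S : Finset (Fin N), S.map v.succAboveEmb = T.erase v := by
  refine ⟨univ.filter (v.succAbove · ∈ T), ?_⟩
  ext x
  simp only [mem_map, mem_filter, mem_univ, true_and, Fin.succAboveEmb_apply, mem_erase]
  constructor
  · rintro ⟨i, h, rfl⟩
    exact ⟨Fin.succAbove_ne _ _, h⟩
  · rintro ⟨h, h'⟩
    obtain ⟨i, rfl⟩ := Fin.exists_succAbove_eq h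
    exact ⟨i, h', rfl⟩

lemma insert_map_succAbove_injective :
    Function.Injective fun S : Finset (Fin N) => insert v (S.map v.succAboveEmb) := by
  intro S T h
  have := congrArg (fun U => U.erase v) h
  simpa [erase_insert notMem_map_succAbove] using this

lemma card_link : (link v 𝒜).card = {T ∈ 𝒜 | v ∈ T}.card := by
  rw [← card_image_of_injective (link v 𝒜) (insert_map_succAbove_injective (v := v))]
  congr 1
  ext T
  simp only [mem_image, mem_link, mem_filter]
  constructor
  · rintro ⟨S, hS, rfl⟩
    exact ⟨hS, mem_insert_self _ _⟩
  · rintro ⟨hT, hv⟩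
    obtain ⟨S, hS⟩ := exists_map_succAbove (v := v) T
    have : insert v (S.map v.succAboveEmb) = T := by rw [hS, insert_erase hv]
    exact ⟨S, by rwa [this], this⟩

lemma card_del : (del v 𝒜).card = {T ∈ 𝒜 | v ∉ T}.card := by
  rw [← card_image_of_injective (del v 𝒜) (map_injective v.succAboveEmb)]
  congr 1
  ext T
  simp only [mem_image, mem_del, mem_filter]
  constructor
  · rintro ⟨S, hS, rfl⟩
    exact ⟨hS, notMem_map_succAbove⟩
  · rintro ⟨hT, hv⟩
    obtain ⟨S, hS⟩ := exists_map_succAbove (v := v) T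
    rw [erase_eq_of_notMem hv] at hS
    exact ⟨S, by rwa [hS], hS⟩

lemma card_del_add_card_link (v : Fin (N + 1)) (𝒜 : Finset (Finset (Fin (N + 1)))) :
    (del v 𝒜).card + (link v 𝒜).card = 𝒜.card := by
  rw [card_del, card_link, add_comm, card_filter_add_card_filter_not]

lemma del_sized {r : ℕ} (h : (𝒜 : Set (Finset (Fin (N + 1)))).Sized r) :
    (del v 𝒜 : Set (Finset (Fin N))).Sized r := by
  intro S hS
  rw [mem_coe, mem_del] at hS
  simpa using h hS

lemma link_sized {r : ℕ} (h : (𝒜 : Set (Finset (Fin (N + 1)))).Sized (r + 1)) :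
    (link v 𝒜 : Set (Finset (Fin N))).Sized r := by
  intro S hS
  rw [mem_coe, mem_link] at hS
  have := h hS
  rw [card_insert_of_notMem notMem_map_succAbove, card_map] at this
  omega

lemma levelShadow_del_subset {c : ℕ} : levelShadow c (del v 𝒜) ⊆ del v (levelShadow c 𝒜) := by
  intro S hS
  obtain ⟨h1, T, hT, h2⟩ := mem_levelShadow.1 hS
  rw [mem_del, mem_levelShadow]
  exact ⟨by simpa using h1, _, mem_del.1 hT, map_subset_map.2 h2⟩

lemma levelShadow_link_subset {c : ℕ} :
    levelShadow c (link v 𝒜) ⊆ link v (levelShadow (c + 1) 𝒜) := by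
  intro S hS
  obtain ⟨h1, T, hT, h2⟩ := mem_levelShadow.1 hS
  rw [mem_link, mem_levelShadow]
  refine ⟨?_, _, mem_link.1 hT, insert_subset_insert _ (map_subset_map.2 h2)⟩
  rw [card_insert_of_notMem notMem_map_succAbove, card_map, h1]

lemma levelShadow_link_subset_del {c : ℕ} :
    levelShadow c (link v 𝒜) ⊆ del v (levelShadow c 𝒜) := by
  intro S hS
  obtain ⟨h1, T, hT, h2⟩ := mem_levelShadow.1 hS
  rw [mem_del, mem_levelShadow]
  exact ⟨by simpa using h1, _, mem_link.1 hT, (map_subset_map.2 h2).trans (subset_insert _ _)⟩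

end link

/-! ### Kruskal–Katona in recursive form -/

lemma exists_isInitSeg_card_eq {α : Type*} [Fintype α] [LinearOrder α] {r m : ℕ}
    (hm : m ≤ (Fintype.card α).choose r) :
    ∃ 𝒞 : Finset (Finset α), Colex.IsInitSeg 𝒞 r ∧ 𝒞.card = m := by
  induction m with
  | zero => exact ⟨∅, by simp⟩
  | succ m ih =>
    obtain ⟨𝒞, h𝒞, hcard⟩ := ih (by omega)
    have hne : (powersetCard r (univ : Finset α) \ 𝒞).Nonempty := by
      rw [← card_pos]
      have := le_card_sdiff 𝒞 (powersetCard r (univ : Finset α))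
      simp only [card_powersetCard, card_univ] at this
      omega
    -- The colex-least missing set can be added without breaking the segment.
    obtain ⟨S, hS, hmin⟩ := exists_min_image _ (fun T : Finset α => toColex T) hne
    simp only [mem_sdiff, mem_powersetCard, subset_univ, true_and] at hS hmin
    refine ⟨insert S 𝒞, ⟨?_, ?_⟩, by rw [card_insert_of_notMem hS.2, hcard]⟩
    · intro T hT
      rcases mem_insert.1 (mem_coe.1 hT) with rfl | hT
      · exact hS.1
      · exact h𝒞.1 hT
    · rintro T U hT ⟨hlt, hU⟩
      by_contra hU'
      rw [mem_insert, not_or] at hU'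
      rcases mem_insert.1 hT with rfl | hT
      · exact absurd hlt (not_lt.2 (hmin U ⟨hU, hU'.2⟩))
      · exact hU'.2 (h𝒞.2 hT ⟨hlt, hU⟩)

/-- A recursive form of the Kruskal–Katona theorem: the family may be replaced by one that consists
of the sets of `X` and of the sets of `Y` with a new point added, where `Y` is empty or `X` is
the family of all sets of the given size. -/
lemma exists_split {N r : ℕ} {𝒜 : Finset (Finset (Fin (N + 1)))}
    (h𝒜 : (𝒜 : Set (Finset (Fin (N + 1)))).Sized (r + 1)) :
    ∃ X Y : Finset (Finset (Fin N)),
      (X : Set (Finset (Fin N))).Sized (r + 1) ∧ (Y : Set (Finset (Fin N))).Sized r ∧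
      X.card + Y.card = 𝒜.card ∧ (Y = ∅ ∨ X.card = N.choose (r + 1)) ∧
      (∀ c ≤ r + 1, (levelShadow c X).card ≤ (levelShadow c 𝒜).card) ∧
      ∀ c ≤ r, (levelShadow (c + 1) X).card + (levelShadow c Y).card ≤
        (levelShadow (c + 1) 𝒜).card := by
  obtain ⟨𝒞, h𝒞, hcard⟩ := exists_isInitSeg_card_eq (α := Fin (N + 1)) (r := r + 1)
    (m := 𝒜.card) h𝒜.card_le
  have key : ∀ c ≤ r + 1, (levelShadow c 𝒞).card ≤ (levelShadow c 𝒜).card := by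
    intro c hc
    rw [levelShadow_eq_iterate h𝒞.1 hc, levelShadow_eq_iterate h𝒜 hc]
    exact iterated_kk h𝒜 hcard.le h𝒞
  refine ⟨del (Fin.last N) 𝒞, link (Fin.last N) 𝒞, del_sized h𝒞.1, link_sized h𝒞.1,
    by rw [card_del_add_card_link, hcard], ?_, ?_, ?_⟩
  · by_cases hY : link (Fin.last N) 𝒞 = ∅
    · exact Or.inl hY
    right
    obtain ⟨T, hT⟩ := nonempty_iff_ne_empty.2 hY
    rw [mem_link] at hT
    -- Every set avoiding the last point precedes in colex any set containing it, so one member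
    -- through that point forces all sets avoiding it.
    suffices del (Fin.last N) 𝒞 = powersetCard (r + 1) univ by simp [this]
    ext S
    simp only [mem_del, mem_powersetCard, subset_univ, true_and]
    refine ⟨fun h => by simpa using h𝒞.1 h, fun h => h𝒞.2 hT ⟨?_, by simpa using h⟩⟩
    refine ((Colex.toColex_lt_singleton (a := Fin.last N)).2 ?_).trans_le
      (Colex.toColex_mono (by simp))
    intro b hb
    exact lt_of_le_of_ne (Fin.le_last b) fun h => notMem_map_succAbove (h ▸ hb)
  · intro c hc
    refine (card_le_card levelShadow_del_subset).trans (le_trans ?_ (key c hc))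
    rw [← card_del_add_card_link (Fin.last N) (levelShadow c 𝒞)]
    omega
  · intro c hc
    refine le_trans ?_ (key (c + 1) (by omega))
    rw [← card_del_add_card_link (Fin.last N) (levelShadow (c + 1) 𝒞)]
    exact add_le_add (card_le_card levelShadow_del_subset) (card_le_card levelShadow_link_subset)

/-! ### Inequalities between ratios -/

section arith

variable {P p w w' x d : ℕ}

/-- In ratios: a full layer `P` has shadow `p`, the top layer `w` has shadow `w'`, and `w'/w ≤ p/P`.
Replacing the top layer by a part `x` with shadow `d`, `d/x ≥ w'/w`, shifts weight to the larger
ratio `p/P`, so the overall ratio does not drop. -/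
lemma add_mul_add_le (h : P * w' ≤ p * w) (hd : x * w' ≤ d * w) (hx : x ≤ w) :
    (P + x) * (p + w') ≤ (p + d) * (P + w) := by
  rcases Nat.eq_zero_or_pos w with rfl | hw
  · obtain rfl : x = 0 := by omega
    have : P * w' = 0 := by simpa using h
    nlinarith
  obtain ⟨y, rfl⟩ := Nat.exists_eq_add_of_le hx
  have h1 : y * (P * w') ≤ y * (p * (x + y)) := Nat.mul_le_mul_left y h
  have h2 : P * (x * w') ≤ P * (d * (x + y)) := Nat.mul_le_mul_left P hd
  refine Nat.le_of_mul_le_mul_right (c := x + y) ?_ hw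
  have h3 := Nat.mul_le_mul_right (x + y) hd
  nlinarith

lemma add_mul_add_lt (h : P * w' < p * w) (hd : x * w' ≤ d * w) (hx : x < w) :
    (P + x) * (p + w') < (p + d) * (P + w) := by
  obtain ⟨y, rfl⟩ := Nat.exists_eq_add_of_le hx.le
  have h1 : y * (P * w') < y * (p * (x + y)) := Nat.mul_lt_mul_of_pos_left h (by omega)
  have h2 : P * (x * w') ≤ P * (d * (x + y)) := Nat.mul_le_mul_left P hd
  refine Nat.lt_of_mul_lt_mul_right (a := x + y) ?_
  have h3 := Nat.mul_le_mul_right (x + y) hd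
  nlinarith

/-- The case without a top layer: `d/x ≥ p/P`, and `p/P` is at least the mediant `(p+w')/(P+w)`. -/
lemma mul_add_le (h : P * w' ≤ p * w) (hd : x * p ≤ d * P) (hx : x ≤ P) :
    x * (p + w') ≤ d * (P + w) := by
  rcases Nat.eq_zero_or_pos P with rfl | hP
  · obtain rfl : x = 0 := by omega
    simp
  refine Nat.le_of_mul_le_mul_right (c := P) ?_ hP
  have h1 : x * (P * w') ≤ x * (p * w) := Nat.mul_le_mul_left x h
  have h2 := Nat.mul_le_mul_right (P + w) hd
  nlinarith

lemma mul_add_lt (h : P * w' < p * w) (hd : x * p ≤ d * P) (hx0 : 0 < x) :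
    x * (p + w') < d * (P + w) := by
  refine Nat.lt_of_mul_lt_mul_right (a := P) ?_
  have h1 : x * (P * w') < x * (p * w) := Nat.mul_lt_mul_of_pos_left h hx0
  have h2 := Nat.mul_le_mul_right (P + w) hd
  nlinarith

lemma choose_mul_choose_le {N r c : ℕ} (hc : c ≤ r) :
    N.choose (r + 1) * N.choose c ≤ N.choose (c + 1) * N.choose r := by
  have h1 := Nat.choose_succ_right_eq N c
  have h2 := Nat.choose_succ_right_eq N r
  have h3 : (N - r) * (c + 1) ≤ (N - c) * (r + 1) := Nat.mul_le_mul (by omega) (by omega)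
  refine Nat.le_of_mul_le_mul_right (c := (c + 1) * (r + 1)) ?_ (by positivity)
  calc _ = (N.choose (r + 1) * (r + 1)) * (N.choose c * (c + 1)) := by ring
    _ = N.choose r * N.choose c * ((N - r) * (c + 1)) := by rw [h2]; ring
    _ ≤ N.choose r * N.choose c * ((N - c) * (r + 1)) := Nat.mul_le_mul_left _ h3
    _ = (N.choose (c + 1) * (c + 1)) * (N.choose r * (r + 1)) := by rw [h1]; ring
    _ = _ := by ring

lemma choose_mul_choose_lt {N r c : ℕ} (hc : c < r) (hr : r ≤ N) :
    N.choose (r + 1) * N.choose c < N.choose (c + 1) * N.choose r := by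
  have h1 := Nat.choose_succ_right_eq N c
  have h2 := Nat.choose_succ_right_eq N r
  have h3 : (N - r) * (c + 1) < (N - c) * (r + 1) :=
    Nat.mul_lt_mul_of_le_of_lt (by omega) (by omega) (by omega)
  have h4 : 0 < N.choose r * N.choose c :=
    Nat.mul_pos (Nat.choose_pos hr) (Nat.choose_pos (by omega))
  refine Nat.lt_of_mul_lt_mul_right (a := (c + 1) * (r + 1)) ?_
  calc _ = (N.choose (r + 1) * (r + 1)) * (N.choose c * (c + 1)) := by ring
    _ = N.choose r * N.choose c * ((N - r) * (c + 1)) := by rw [h2]; ring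
    _ < N.choose r * N.choose c * ((N - c) * (r + 1)) := Nat.mul_lt_mul_of_pos_left h3 h4
    _ = (N.choose (c + 1) * (c + 1)) * (N.choose r * (r + 1)) := by rw [h1]; ring
    _ = _ := by ring

end arith

/-! ### Counting sets that do not contain a fixed set -/

/-- The number of `r`-element subsets of an `N`-element set that do not contain a fixed
`τ`-element set, for `τ ≤ r ≤ N`. -/
def avoidCount : ℕ → ℕ → ℕ → ℕ
  -- Split by a point of the fixed set: a set misses it, or contains it and fails to contain the
  -- rest.
  | N + 1, r + 1, τ + 1 => N.choose (r + 1) + avoidCount N r τ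
  -- For `τ = 0` this is the true count, since every set contains the empty set; the other cases lie
  -- outside `τ ≤ r ≤ N`, apart from those with `τ = 0`.
  | _, _, _ => 0

@[simp] lemma avoidCount_zero_right (N r : ℕ) : avoidCount N r 0 = 0 := by
  cases N <;> cases r <;> rfl

@[simp] lemma avoidCount_zero_left (r τ : ℕ) : avoidCount 0 r τ = 0 := by
  cases r <;> rfl

@[simp] lemma avoidCount_zero_mid (N τ : ℕ) : avoidCount N 0 τ = 0 := by
  cases N <;> rfl

lemma avoidCount_succ (N r τ : ℕ) :
    avoidCount (N + 1) (r + 1) (τ + 1) = N.choose (r + 1) + avoidCount N r τ := rfl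

lemma avoidCount_add {N r τ : ℕ} (hτ : τ ≤ r) (hr : r ≤ N) :
    avoidCount N r τ + (N - τ).choose (r - τ) = N.choose r := by
  induction N generalizing r τ with
  | zero => obtain rfl : r = 0 := by omega
            obtain rfl : τ = 0 := by omega
            simp
  | succ N ih =>
    cases τ with
    | zero => simp
    | succ τ =>
      obtain ⟨r, rfl⟩ : ∃ s, r = s + 1 := ⟨r - 1, by omega⟩
      have := ih (r := r) (τ := τ) (by omega) (by omega)
      rw [avoidCount_succ, Nat.choose_succ_succ' N r, ← this, Nat.add_sub_add_right,
        Nat.add_sub_add_right]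
      omega

lemma avoidCount_self (N τ : ℕ) : avoidCount N N τ = 0 := by
  induction N generalizing τ with
  | zero => simp
  | succ N ih => cases τ <;> simp [avoidCount_succ, ih]

/-- This is the hypothesis `w'/w ≤ p/P` of the ratio inequalities with `w = avoidCount N r τ`. After
absorption both sides carry the factor `N + 1`; the two summands are then compared by `c ≤ r` and by
induction. -/
lemma choose_mul_avoidCount_le {N r c τ : ℕ} (hc : c ≤ r) :
    N.choose (r + 1) * avoidCount N c τ ≤ N.choose (c + 1) * avoidCount N r τ := by
  induction N generalizing r c τ with
  | zero => simp
  | succ N ih =>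
    rcases τ with _ | τ
    · simp
    rcases c with _ | c
    · simp
    obtain ⟨r, rfl⟩ : ∃ s, r = s + 1 := ⟨r - 1, by omega⟩
    have h1 := ih (r := r) (c := c) (τ := τ) (by omega)
    have h2 := Nat.add_one_mul_choose_eq N (c + 1)
    have h3 := Nat.add_one_mul_choose_eq N (r + 1)
    rw [avoidCount_succ, avoidCount_succ]
    refine Nat.le_of_mul_le_mul_right (c := (c + 2) * (r + 2)) ?_ (by positivity)
    calc _ = ((N + 1).choose (r + 2) * (r + 2)) *
          ((c + 2) * (N.choose (c + 1) + avoidCount N c τ)) := by ring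
      _ = (N + 1) * ((c + 2) * (N.choose (r + 1) * N.choose (c + 1)) +
          (c + 2) * (N.choose (r + 1) * avoidCount N c τ)) := by rw [← h3]; ring
      _ ≤ (N + 1) * ((r + 2) * (N.choose (r + 1) * N.choose (c + 1)) +
          (r + 2) * (N.choose (c + 1) * avoidCount N r τ)) := by gcongr <;> omega
      _ = ((N + 1).choose (c + 2) * (c + 2)) *
          ((r + 2) * (N.choose (r + 1) + avoidCount N r τ)) := by rw [← h2]; ring
      _ = _ := by ring

lemma choose_mul_avoidCount_lt {N r c τ : ℕ} (hc : c < r) (hτ : τ ≤ c) (hr : r ≤ N)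
    (h0 : 0 < avoidCount N r τ) :
    N.choose (r + 1) * avoidCount N c τ < N.choose (c + 1) * avoidCount N r τ := by
  rcases N with _ | N
  · simp at h0
  rcases τ with _ | τ
  · simp at h0
  obtain ⟨c, rfl⟩ : ∃ s, c = s + 1 := ⟨c - 1, by omega⟩
  obtain ⟨r, rfl⟩ : ∃ s, r = s + 1 := ⟨r - 1, by omega⟩
  have hrN : r + 1 ≤ N := by
    by_contra h
    obtain rfl : r = N := by omega
    simp [avoidCount_self] at h0
  have h1 := choose_mul_avoidCount_le (N := N) (r := r) (c := c) (τ := τ) (by omega)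
  have h2 := Nat.add_one_mul_choose_eq N (c + 1)
  have h3 := Nat.add_one_mul_choose_eq N (r + 1)
  have h4 : 0 < N.choose (r + 1) * N.choose (c + 1) :=
    Nat.mul_pos (Nat.choose_pos hrN) (Nat.choose_pos (by omega))
  rw [avoidCount_succ, avoidCount_succ]
  refine Nat.lt_of_mul_lt_mul_right (a := (c + 2) * (r + 2)) ?_
  calc _ = ((N + 1).choose (r + 2) * (r + 2)) *
        ((c + 2) * (N.choose (c + 1) + avoidCount N c τ)) := by ring
    _ = (N + 1) * ((c + 2) * (N.choose (r + 1) * N.choose (c + 1)) +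
        (c + 2) * (N.choose (r + 1) * avoidCount N c τ)) := by rw [← h3]; ring
    _ < (N + 1) * ((r + 2) * (N.choose (r + 1) * N.choose (c + 1)) +
        (r + 2) * (N.choose (c + 1) * avoidCount N r τ)) := by
      refine Nat.mul_lt_mul_of_pos_left (Nat.add_lt_add_of_lt_of_le ?_ ?_) (by omega)
      · exact Nat.mul_lt_mul_of_pos_right (by omega) h4
      · exact Nat.mul_le_mul (by omega) h1
    _ = ((N + 1).choose (c + 2) * (c + 2)) *
        ((r + 2) * (N.choose (r + 1) + avoidCount N r τ)) := by rw [← h2]; ring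
    _ = _ := by ring

/-! ### Lower bounds for shadow ratios -/

section ratio

variable {N r c τ : ℕ} {𝒜 : Finset (Finset (Fin N))}

/-- The normalized matching property of the Boolean lattice, with the case of equality. -/
lemma card_mul_choose_le_and_lt (h𝒜 : (𝒜 : Set (Finset (Fin N))).Sized r) (hc : c ≤ r) :
    𝒜.card * N.choose c ≤ (levelShadow c 𝒜).card * N.choose r ∧
      (c < r → 0 < 𝒜.card → 𝒜.card < N.choose r →
        𝒜.card * N.choose c < (levelShadow c 𝒜).card * N.choose r) := by
  have hle : 𝒜.card ≤ N.choose r := by simpa using h𝒜.card_le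
  rcases Nat.eq_zero_or_pos 𝒜.card with h0 | h0
  · simp [h0]
  induction N generalizing r c with
  | zero =>
    obtain rfl : r = 0 := by
      by_contra h
      rw [Nat.choose_eq_zero_of_lt (by omega)] at hle
      omega
    obtain rfl : c = 0 := by omega
    have := card_levelShadow_of_full le_rfl (by simp) h𝒜
      (by simp only [Nat.choose_zero_right] at hle ⊢; omega)
    simp only [Nat.choose_zero_right] at this hle ⊢
    omega
  | succ N ih =>
    rcases c with _ | c
    · have h1 : 1 ≤ (levelShadow 0 𝒜).card := by
        obtain ⟨T, hT⟩ := card_pos.1 h0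
        exact card_pos.2 ⟨∅, mem_levelShadow.2 ⟨rfl, T, hT, empty_subset _⟩⟩
      have h2 := Nat.mul_le_mul_right ((N + 1).choose r) h1
      simp only [Nat.choose_zero_right, mul_one, one_mul] at h2 ⊢
      exact ⟨hle.trans h2, fun _ _ h => h.trans_le h2⟩
    obtain ⟨r, rfl⟩ : ∃ s, r = s + 1 := ⟨r - 1, by omega⟩
    rcases Nat.lt_or_ge N (r + 1) with hrN | hrN
    · have hr : r = N := by
        by_contra h
        rw [Nat.choose_eq_zero_of_lt (by omega)] at hle
        omega
      subst hr
      have h1 : 𝒜.card = (r + 1).choose (r + 1) := by rw [Nat.choose_self] at hle ⊢; omega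
      refine ⟨?_, fun _ _ h => absurd h1 h.ne⟩
      have := card_levelShadow_of_full hc (by simp) h𝒜 (by simpa using h1)
      simp only [Fintype.card_fin] at this
      rw [this, h1, mul_comm]
    obtain ⟨X, Y, hX, hY, hcard, hXY, hsh, hsh'⟩ := exists_split h𝒜
    have hX' : X.card ≤ N.choose (r + 1) := by simpa using hX.card_le
    have hY' : Y.card ≤ N.choose r := by simpa using hY.card_le
    have hXs : X.card * N.choose (c + 1) ≤ (levelShadow (c + 1) X).card * N.choose (r + 1) := by
      rcases Nat.eq_zero_or_pos X.card with h | h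
      · simp [h]
      · exact (ih hX hc hX' h).1
    have hYs : Y.card * N.choose c ≤ (levelShadow c Y).card * N.choose r := by
      rcases Nat.eq_zero_or_pos Y.card with h | h
      · simp [h]
      · exact (ih hY (by omega) hY' h).1
    have hq := choose_mul_choose_le (N := N) (r := r) (c := c) (by omega)
    have hq' (h : c + 1 < r + 1) := choose_mul_choose_lt (N := N) (r := r) (c := c)
      (by omega) (by omega)
    rw [← hcard, Nat.choose_succ_succ' N c, Nat.choose_succ_succ' N r,
      add_comm (N.choose c), add_comm (N.choose r)]
    by_cases hY0 : Y = ∅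
    · subst hY0
      have hs := Nat.mul_le_mul_right (N.choose (r + 1) + N.choose r) (hsh (c + 1) hc)
      rw [card_empty, add_zero] at hcard ⊢
      exact ⟨(mul_add_le hq hXs hX').trans hs,
        fun h _ _ => (mul_add_lt (hq' h) hXs (by omega)).trans_le hs⟩
    · replace hXY := hXY.resolve_left hY0
      have hfull := card_levelShadow_of_full hc (by simpa using hrN) hX (by simpa using hXY)
      rw [Fintype.card_fin] at hfull
      have hs := Nat.mul_le_mul_right (N.choose (r + 1) + N.choose r) (hsh' c (by omega))
      rw [hfull] at hs
      rw [hXY]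
      exact ⟨(add_mul_add_le hq hYs hY').trans hs,
        fun h _ h' => (add_mul_add_lt (hq' h) hYs (by omega)).trans_le hs⟩

/-- The shadow ratio of a family that is at most as large as the family of all sets that do not
contain a fixed `τ`-element set is at least the ratio of that family; with the case of equality. -/
lemma card_mul_avoidCount_le_and_lt (h𝒜 : (𝒜 : Set (Finset (Fin N))).Sized r) (hτ : τ ≤ c)
    (hc : c ≤ r) (hr : r ≤ N) (hle : 𝒜.card ≤ avoidCount N r τ) :
    𝒜.card * avoidCount N c τ ≤ (levelShadow c 𝒜).card * avoidCount N r τ ∧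
      (c < r → 0 < 𝒜.card → 𝒜.card < avoidCount N r τ →
        𝒜.card * avoidCount N c τ < (levelShadow c 𝒜).card * avoidCount N r τ) := by
  rcases Nat.eq_zero_or_pos 𝒜.card with h0 | h0
  · simp [h0]
  induction N generalizing r c τ with
  | zero => simp at hle; simp [hle] at h0
  | succ N ih =>
    rcases τ with _ | τ
    · simp at hle; simp [hle] at h0
    obtain ⟨c, rfl⟩ : ∃ s, c = s + 1 := ⟨c - 1, by omega⟩
    obtain ⟨r, rfl⟩ : ∃ s, r = s + 1 := ⟨r - 1, by omega⟩
    have hrN : r + 1 ≤ N := by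
      by_contra h
      obtain rfl : r = N := by omega
      rw [avoidCount_self] at hle
      omega
    rw [avoidCount_succ] at hle
    obtain ⟨X, Y, hX, hY, hcard, hXY, hsh, hsh'⟩ := exists_split h𝒜
    have hX' : X.card ≤ N.choose (r + 1) := by simpa using hX.card_le
    obtain ⟨hXs, hXs'⟩ := card_mul_choose_le_and_lt hX hc
    have hq := choose_mul_avoidCount_le (N := N) (r := r) (c := c) (τ := τ) (by omega)
    have hq' (h : c + 1 < r + 1) := choose_mul_avoidCount_lt (N := N) (r := r) (c := c) (τ := τ)
      (by omega) (by omega) (by omega)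
    rw [avoidCount_succ, avoidCount_succ, ← hcard]
    by_cases hY0 : Y = ∅
    · subst hY0
      have hs := Nat.mul_le_mul_right (N.choose (r + 1) + avoidCount N r τ) (hsh (c + 1) hc)
      rw [card_empty, add_zero] at hcard ⊢
      refine ⟨(mul_add_le hq hXs hX').trans hs, fun h _ h' => lt_of_lt_of_le ?_ hs⟩
      -- With no fixed points left the top layer is empty, so `mul_add_lt` gives no strictness; it
      -- comes from normalized matching instead.
      rcases τ with _ | τ
      · simp only [avoidCount_zero_right, add_zero] at h' ⊢
        exact hXs' h (by omega) h'
      · refine mul_add_lt (hq' h ?_) hXs (by omega)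
        obtain ⟨M, rfl⟩ : ∃ s, N = s + 1 := ⟨N - 1, by omega⟩
        obtain ⟨s, rfl⟩ : ∃ s, r = s + 1 := ⟨r - 1, by omega⟩
        rw [avoidCount_succ]
        have := Nat.choose_pos (n := M) (k := s + 1) (by omega)
        omega
    · replace hXY := hXY.resolve_left hY0
      have hY' : Y.card ≤ avoidCount N r τ := by omega
      have hYs := (ih hY (τ := τ) (c := c) (by omega) (by omega) (by omega) hY'
        (card_pos.2 (nonempty_iff_ne_empty.2 hY0))).1
      have hfull := card_levelShadow_of_full hc (by simpa using hrN) hX (by simpa using hXY)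
      rw [Fintype.card_fin] at hfull
      have hs := Nat.mul_le_mul_right (N.choose (r + 1) + avoidCount N r τ) (hsh' c (by omega))
      rw [hfull] at hs
      rw [hXY]
      exact ⟨(add_mul_add_le hq hYs hY').trans hs,
        fun h _ h' => (add_mul_add_lt (hq' h (by omega)) hYs (by omega)).trans_le hs⟩

end ratio

/-! ### Uniqueness in Kruskal–Katona by counting degrees -/

lemma sum_card_link {N r : ℕ} {𝒜 : Finset (Finset (Fin (N + 1)))}
    (h : (𝒜 : Set (Finset (Fin (N + 1)))).Sized r) : ∑ v, (link v 𝒜).card = r * 𝒜.card := by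
  simp_rw [card_link, card_filter]
  rw [sum_comm]
  simp_rw [sum_boole, filter_mem_eq_inter, univ_inter, Nat.cast_id]
  rw [sum_congr rfl fun T hT => h (mem_coe.2 hT), sum_const, smul_eq_mul, mul_comm]

/-- The bound on the degree of a point in a family in terms of its degree in the shadow. -/
lemma mul_card_link_le {m c : ℕ} {𝒞 : Finset (Finset (Fin (m + 1)))} (v : Fin (m + 1))
    (hcm : c + 1 < m) (h𝒞 : (𝒞 : Set (Finset (Fin (m + 1)))).Sized (c + 2))
    (hsh : (levelShadow (c + 1) 𝒞).card ≤ m.choose (c + 1)) :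
    (c + 1) * (link v 𝒞).card ≤ (m - (c + 1)) * (link v (levelShadow (c + 1) 𝒞)).card ∧
    ((c + 1) * (link v 𝒞).card = (m - (c + 1)) * (link v (levelShadow (c + 1) 𝒞)).card →
      (link v (levelShadow (c + 1) 𝒞)).card = 0 ∨
      (link v (levelShadow (c + 1) 𝒞)).card = (m - 1).choose c) := by
  obtain ⟨m, rfl⟩ : ∃ s, m = s + 1 := ⟨m - 1, by omega⟩
  have hX : (link v 𝒞 : Set (Finset (Fin (m + 1)))).Sized (c + 1) := link_sized h𝒞
  have hsum := card_del_add_card_link v (levelShadow (c + 1) 𝒞)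
  have hDE : (levelShadow c (link v 𝒞)).card ≤ (link v (levelShadow (c + 1) 𝒞)).card :=
    card_le_card levelShadow_link_subset
  have hXdel : (link v 𝒞).card ≤ (del v (levelShadow (c + 1) 𝒞)).card := by
    refine card_le_card fun S hS => levelShadow_link_subset_del ?_
    exact mem_levelShadow.2 ⟨hX hS, S, hS, Subset.rfl⟩
  generalize (del v (levelShadow (c + 1) 𝒞)).card = del' at *
  generalize (link v (levelShadow (c + 1) 𝒞)).card = E at *
  generalize (levelShadow (c + 1) 𝒞).card = D at *
  generalize link v 𝒞 = X at *
  obtain ⟨q, hq⟩ : ∃ q, m + 1 - (c + 1) = q := ⟨_, rfl⟩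
  have hmq : m = q + c := by omega
  rw [hq, Nat.add_sub_cancel]
  have hch := Nat.add_one_mul_choose_eq m c
  -- For large `E`, the link and the link of the shadow have total size at most that of the shadow,
  -- and this suffices. For small `E`, the link compresses to a family missing a further point,
  -- where normalized matching is strict.
  rcases Nat.lt_or_ge E (m.choose c) with hE | hE
  swap
  · have h1 : (c + 1) * X.card + (c + 1) * E ≤ (m + 1) * m.choose c := by
      calc _ = (X.card + E) * (c + 1) := by ring
        _ ≤ (m + 1).choose (c + 1) * (c + 1) := Nat.mul_le_mul_right _ (by omega)
        _ = _ := hch.symm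
    have h2 : (m + 1) * m.choose c ≤ (m + 1) * E := Nat.mul_le_mul_left _ hE
    have h3 : (m + 1) * E = q * E + (c + 1) * E := by rw [hmq]; ring
    refine ⟨by omega, fun h => Or.inr ?_⟩
    refine Nat.eq_of_mul_eq_mul_left (Nat.succ_pos m) ?_
    rw [Nat.succ_eq_add_one]
    omega
  rcases Nat.eq_zero_or_pos X.card with h0 | h0
  · rw [h0, mul_zero]
    refine ⟨Nat.zero_le _, fun h => Or.inl ?_⟩
    have : q ≠ 0 := by omega
    simpa [this] using h.symm
  obtain ⟨X₁, Y, hX₁, hY, hcard, hXY, hs, -⟩ := exists_split hX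
  have hX₁' : X₁.card ≤ m.choose (c + 1) := by simpa using hX₁.card_le
  have hs := hs c (by omega)
  have hlt : X₁.card < m.choose (c + 1) := by
    refine lt_of_le_of_ne hX₁' fun h => ?_
    have := card_levelShadow_of_full (c := c) (by omega) (by rw [Fintype.card_fin]; omega) hX₁
      (by simpa using h)
    rw [Fintype.card_fin] at this
    omega
  obtain rfl : Y = ∅ := hXY.resolve_right hlt.ne
  rw [card_empty, add_zero] at hcard
  have key := (card_mul_choose_le_and_lt hX₁ (c := c) (by omega)).2 (by omega) (by omega) hlt
  have hpos : 0 < m.choose c := Nat.choose_pos (by omega)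
  have hch' := Nat.choose_succ_right_eq m c
  have : (c + 1) * X.card < q * E := by
    refine Nat.lt_of_mul_lt_mul_right (a := m.choose c) ?_
    calc (c + 1) * X.card * m.choose c = X₁.card * m.choose c * (c + 1) := by rw [hcard]; ring
      _ < (levelShadow c X₁).card * m.choose (c + 1) * (c + 1) :=
        Nat.mul_lt_mul_of_pos_right key (by omega)
      _ ≤ E * m.choose (c + 1) * (c + 1) := by gcongr; omega
      _ = q * E * m.choose c := by
        rw [mul_assoc, hch', show m - c = q by omega]; ring
  exact ⟨this.le, fun h => absurd h this.ne⟩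

/-- The uniqueness part of the Kruskal–Katona theorem for families that are as large as the family
of all sets avoiding one point. -/
lemma exists_forall_notMem {m c : ℕ} {𝒞 : Finset (Finset (Fin (m + 1)))} (hc : 1 ≤ c)
    (hcm : c < m) (h𝒞 : (𝒞 : Set (Finset (Fin (m + 1)))).Sized (c + 1))
    (hcard : m.choose (c + 1) ≤ 𝒞.card) (hsh : (levelShadow c 𝒞).card ≤ m.choose c) :
    ∃ v, ∀ T ∈ 𝒞, v ∉ T := by
  obtain ⟨c, rfl⟩ : ∃ s, c = s + 1 := ⟨c - 1, by omega⟩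
  have hloc v := mul_card_link_le v hcm h𝒞 hsh
  have h1 := sum_card_link h𝒞
  have h2 := sum_card_link (levelShadow_sized (c := c + 1) (𝒜 := 𝒞))
  have hch := Nat.choose_succ_right_eq m (c + 1)
  have hle : ∑ v, (c + 1) * (link v 𝒞).card ≤
      ∑ v, (m - (c + 1)) * (link v (levelShadow (c + 1) 𝒞)).card :=
    sum_le_sum fun v _ => (hloc v).1
  have hD : (m - (c + 1)) * ((c + 1) * (levelShadow (c + 1) 𝒞).card) ≤
      (m - (c + 1)) * ((c + 1) * m.choose (c + 1)) := by gcongr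
  have hge : (m - (c + 1)) * ((c + 1) * m.choose (c + 1)) ≤
      (c + 1) * ((c + 2) * 𝒞.card) := by
    calc _ = (c + 1) * (m.choose (c + 1) * (m - (c + 1))) := by ring
      _ = (c + 1) * ((c + 2) * m.choose (c + 2)) := by rw [← hch]; ring
      _ ≤ _ := by gcongr
  have hle' := hle
  rw [← mul_sum, ← mul_sum, h1, h2] at hle'
  -- Summed over all points, the local bounds meet the bounds on `𝒞` and its shadow with no slack,
  -- so each is an equality.
  have heq : ∀ v ∈ univ, (c + 1) * (link v 𝒞).card =
      (m - (c + 1)) * (link v (levelShadow (c + 1) 𝒞)).card := by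
    refine (sum_eq_sum_iff_of_le fun v _ => (hloc v).1).1 (le_antisymm hle ?_)
    rw [← mul_sum, ← mul_sum, h1, h2]
    exact hD.trans hge
  have hDeq : (levelShadow (c + 1) 𝒞).card = m.choose (c + 1) := by
    have h3 : (m - (c + 1)) * ((c + 1) * (levelShadow (c + 1) 𝒞).card) =
      (m - (c + 1)) * ((c + 1) * m.choose (c + 1)) := le_antisymm hD (hge.trans hle')
    exact Nat.eq_of_mul_eq_mul_left (Nat.succ_pos c) (Nat.eq_of_mul_eq_mul_left (by omega) h3)
  obtain ⟨v, hv⟩ : ∃ v, (link v (levelShadow (c + 1) 𝒞)).card = 0 := by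
    by_contra! hne
    -- If every shadow degree were `C(m-1,c)`, the `m + 1` points would give a degree sum exceeding
    -- `(c+1) C(m,c+1) = m C(m-1,c)`.
    have h4 v := ((hloc v).2 (heq v (mem_univ v))).resolve_left (hne v)
    rw [sum_congr rfl fun v _ => h4 v, sum_const, card_univ, Fintype.card_fin, smul_eq_mul,
      hDeq] at h2
    obtain ⟨m, rfl⟩ : ∃ s, m = s + 1 := ⟨m - 1, by omega⟩
    have h5 := Nat.add_one_mul_choose_eq m c
    have h6 : 0 < m.choose c := Nat.choose_pos (by omega)
    rw [Nat.add_sub_cancel] at h2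
    nlinarith
  have hv' := heq v (mem_univ v)
  rw [hv, mul_zero] at hv'
  have hv'' : (link v 𝒞).card = 0 := by simpa using hv'
  rw [card_link, card_eq_zero, filter_eq_empty_iff] at hv''
  exact ⟨v, fun T hT => hv'' hT⟩

/-! ### Cross-intersecting pairs and the families attached to a set -/

section pair

variable {n a b : ℕ} {𝒜 ℬ : Finset (Finset (Fin n))}

lemma sized_of_subset_kSubsets (h : 𝒜 ⊆ kSubsets n a) : (𝒜 : Set (Finset (Fin n))).Sized a := by
  intro S hS
  exact (mem_powersetCard.1 (h hS)).2

lemma mem_kSubsets {S : Finset (Fin n)} : S ∈ kSubsets n a ↔ S.card = a := by simp [kSubsets]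

lemma card_kSubsets : (kSubsets n a).card = n.choose a := by simp [kSubsets]

lemma sized_compls (h : 𝒜 ⊆ kSubsets n a) : (𝒜ᶜˢ : Set (Finset (Fin n))).Sized (n - a) := by
  simpa using (sized_of_subset_kSubsets h).compls

/-- `B` meets `A` exactly when `B` is not contained in the complement of `A`. -/
lemma disjoint_levelShadow_compls (hcross : ∀ A ∈ 𝒜, ∀ B ∈ ℬ, (A ∩ B).Nonempty) :
    Disjoint ℬ (levelShadow b 𝒜ᶜˢ) := by
  rw [disjoint_left]
  intro B hB hB'
  obtain ⟨-, T, hT, h⟩ := mem_levelShadow.1 hB'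
  obtain ⟨x, hx⟩ := hcross _ (mem_compls.1 hT) B hB
  rw [mem_inter, mem_compl] at hx
  exact hx.1 (h hx.2)

lemma card_add_card_levelShadow_le (hℬ : ℬ ⊆ kSubsets n b)
    (hcross : ∀ A ∈ 𝒜, ∀ B ∈ ℬ, (A ∩ B).Nonempty) :
    ℬ.card + (levelShadow b 𝒜ᶜˢ).card ≤ n.choose b := by
  rw [← card_union_of_disjoint (disjoint_levelShadow_compls hcross), ← card_kSubsets]
  refine card_le_card (union_subset hℬ fun S hS => mem_kSubsets.2 (levelShadow_sized hS))

/-- A set that meets all the `a`-element sets meeting `S` contains `S`. -/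
lemma subset_of_forall_inter_nonempty {S B : Finset (Fin n)} (ha : 1 ≤ a) (hB : B.card + a ≤ n)
    (h : ∀ A : Finset (Fin n), A.card = a → (A ∩ S).Nonempty → (A ∩ B).Nonempty) : S ⊆ B := by
  intro x hx
  by_contra hxB
  obtain ⟨A, h1, h2, h3⟩ := exists_subsuperset_card_eq (s := {x}) (t := Bᶜ) (n := a)
    (by simpa using hxB) (by simpa using ha) (by rw [card_compl, Fintype.card_fin]; omega)
  obtain ⟨y, hy⟩ := h A h3 ⟨x, mem_inter.2 ⟨h1 (mem_singleton_self x), hx⟩⟩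
  rw [mem_inter] at hy
  exact mem_compl.1 (h2 hy.1) hy.2

lemma card_filter_inter_nonempty (S : Finset (Fin n)) :
    ((kSubsets n a).filter fun A => (A ∩ S).Nonempty).card + (n - S.card).choose a =
      n.choose a := by
  have h := card_filter_add_card_filter_not (s := kSubsets n a) (fun A => (A ∩ S).Nonempty)
  rw [card_kSubsets] at h
  rw [← h]
  congr 1
  have : (n - S.card).choose a = (powersetCard a Sᶜ).card := by
    rw [card_powersetCard, card_compl, Fintype.card_fin]
  rw [this]
  congr 1
  ext A
  rw [mem_filter, mem_kSubsets, mem_powersetCard, not_nonempty_iff_eq_empty,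
    ← disjoint_iff_inter_eq_empty, subset_compl_iff_disjoint_right, and_comm]

lemma card_filter_superset {S : Finset (Fin n)} (hS : S.card ≤ b) :
    ((kSubsets n b).filter fun B => S ⊆ B).card = (n - S.card).choose (b - S.card) := by
  have : (n - S.card).choose (b - S.card) = (powersetCard (b - S.card) Sᶜ).card := by
    rw [card_powersetCard, card_compl, Fintype.card_fin]
  rw [this]
  refine card_bij' (fun B _ => B \ S) (fun T _ => T ∪ S) ?_ ?_ ?_ ?_
  · intro B hB
    rw [mem_filter, mem_kSubsets] at hB
    rw [mem_powersetCard, card_sdiff_of_subset hB.2, hB.1]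
    exact ⟨fun x hx => mem_compl.2 (mem_sdiff.1 hx).2, rfl⟩
  · intro T hT
    rw [mem_powersetCard, subset_compl_iff_disjoint_right] at hT
    rw [mem_filter, mem_kSubsets, card_union_of_disjoint hT.1, hT.2]
    exact ⟨by omega, subset_union_right⟩
  · intro B hB
    exact sdiff_union_of_subset (mem_filter.1 hB).2
  · intro T hT
    rw [mem_powersetCard, subset_compl_iff_disjoint_right] at hT
    exact union_sdiff_cancel_right hT.1

lemma filter_inter_singleton (x : Fin n) :
    ((kSubsets n a).filter fun A => (A ∩ {x}).Nonempty) =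
      (kSubsets n a).filter fun A => x ∈ A := by
  refine filter_congr fun A _ => ?_
  simp [inter_singleton, apply_ite]

end pair

/-! ### Two families: trade-off and rigidity of stars -/

/-- The trade-off between the sizes of two cross-intersecting families `𝒜` and `ℬ`, when `𝒜` is at
least as large as the family of all sets containing a fixed point. -/
lemma exists_card_add_le {m a b τ x : ℕ} {𝒜 ℬ : Finset (Finset (Fin (m + 1)))}
    (h𝒜 : 𝒜 ⊆ kSubsets (m + 1) (a + 1)) (hℬ : ℬ ⊆ kSubsets (m + 1) (b + 1))
    (hcross : ∀ A ∈ 𝒜, ∀ B ∈ ℬ, (A ∩ B).Nonempty) (hab : a + b + 1 ≤ m) (hτ : τ ≤ b)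
    (hx : 𝒜.card = m.choose a + x) (hxle : x ≤ avoidCount m (m - (a + 1)) τ) :
    ∃ d, ℬ.card + d ≤ m.choose b ∧
      x * avoidCount m b τ ≤ d * avoidCount m (m - (a + 1)) τ ∧
      (a + b + 1 < m → 0 < x → x < avoidCount m (m - (a + 1)) τ →
        x * avoidCount m b τ < d * avoidCount m (m - (a + 1)) τ) := by
  obtain ⟨r, hr⟩ : ∃ r, m - (a + 1) = r := ⟨_, rfl⟩
  have hs := sized_compls h𝒜
  rw [show m + 1 - (a + 1) = r + 1 by omega] at hs
  rw [hr] at hxle ⊢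
  obtain ⟨X, Y, hX, hY, hcard, hXY, -, hsh⟩ := exists_split hs
  have hch : m.choose (r + 1) = m.choose a := Nat.choose_symm_of_eq_add (by omega)
  have hX' : X.card ≤ m.choose (r + 1) := by simpa using hX.card_le
  rw [card_compls] at hcard
  have hXfull : X.card = m.choose (r + 1) := by
    rcases hXY with rfl | h
    · rw [card_empty] at hcard; omega
    · exact h
  have hYx : Y.card = x := by omega
  obtain ⟨h1, h2⟩ := card_mul_avoidCount_le_and_lt hY hτ (by omega) (by omega) (hYx ▸ hxle)
  have h3 := hsh b (by omega)
  have h4 := card_levelShadow_of_full (c := b + 1) (by omega)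
    (by rw [Fintype.card_fin]; omega) hX (by simpa using hXfull)
  rw [Fintype.card_fin] at h4
  have h5 := card_add_card_levelShadow_le hℬ hcross
  rw [Nat.choose_succ_succ' m b] at h5
  rw [hYx] at h1 h2
  -- The loss `d` is the shadow of `Y`: the full layer `X` already excludes `C(m,b+1)` of the
  -- `C(m,b+1) + C(m,b)` candidates.
  exact ⟨_, by omega, h1, fun h => h2 (by omega)⟩

/-- Cross-intersecting families that both have the size of a star are stars. -/
lemma exists_eq_star {n a b : ℕ} {𝒜 ℬ : Finset (Finset (Fin n))} (ha : 1 ≤ a) (hb : 1 ≤ b)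
    (h𝒜 : 𝒜 ⊆ kSubsets n a) (hℬ : ℬ ⊆ kSubsets n b)
    (hcross : ∀ A ∈ 𝒜, ∀ B ∈ ℬ, (A ∩ B).Nonempty) (hab : a + b < n)
    (hca : 𝒜.card = (n - 1).choose (a - 1)) (hcb : ℬ.card = (n - 1).choose (b - 1)) :
    ∃ x : Fin n, 𝒜 = (kSubsets n a).filter (fun A => x ∈ A) := by
  obtain ⟨m, rfl⟩ : ∃ s, n = s + 1 := ⟨n - 1, by omega⟩
  obtain ⟨a, rfl⟩ : ∃ s, a = s + 1 := ⟨a - 1, by omega⟩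
  obtain ⟨b, rfl⟩ : ∃ s, b = s + 1 := ⟨b - 1, by omega⟩
  obtain ⟨r, hr⟩ : ∃ r, m - (a + 1) = r := ⟨_, rfl⟩
  simp only [Nat.add_sub_cancel] at hca hcb
  have hs := sized_compls h𝒜
  rw [show m + 1 - (a + 1) = r + 1 by omega] at hs
  have hch : m.choose (r + 1) = m.choose a := Nat.choose_symm_of_eq_add (by omega)
  have h5 := card_add_card_levelShadow_le hℬ hcross
  rw [Nat.choose_succ_succ' m b, hcb] at h5
  obtain ⟨X, Y, hX, hY, hcard, hXY, hsh, -⟩ := exists_split hs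
  have hX' : X.card ≤ m.choose (r + 1) := by simpa using hX.card_le
  have hpos : 0 < m.choose a := Nat.choose_pos (by omega)
  rw [card_compls] at hcard
  have hXfull : X.card = m.choose (r + 1) := by
    rcases hXY with rfl | h
    · rw [card_empty] at hcard; omega
    · exact h
  have h4 := card_levelShadow_of_full (c := b + 2) (by omega)
    (by rw [Fintype.card_fin]; omega) hX (by simpa using hXfull)
  rw [Fintype.card_fin] at h4
  have h6 := hsh (b + 2) (by omega)
  -- Uniqueness is applied one level above `ℬ`, which exists because `a + b < n`. A point missed by
  -- that whole shadow is missed by every complement.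
  obtain ⟨v, hv⟩ := exists_forall_notMem (𝒞 := levelShadow (b + 2) 𝒜ᶜˢ) (c := b + 1) (m := m)
    (by omega) (by omega) levelShadow_sized (h4 ▸ h6)
    ((card_le_card levelShadow_levelShadow_subset).trans (by omega))
  have hsub : 𝒜 ⊆ (kSubsets (m + 1) (a + 1)).filter (fun A => v ∈ A) := by
    intro A hA
    refine mem_filter.2 ⟨h𝒜 hA, ?_⟩
    by_contra hvA
    have hA' : Aᶜ ∈ 𝒜ᶜˢ := by simpa using hA
    obtain ⟨T, h1, h2, h3⟩ := exists_subsuperset_card_eq (s := {v}) (t := Aᶜ) (n := b + 2)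
      (by simpa using hvA) (by simp) (by have := hs hA'; omega)
    exact hv T (mem_levelShadow.2 ⟨h3, _, hA', h2⟩) (h1 (mem_singleton_self v))
  refine ⟨v, eq_of_subset_of_card_le hsub ?_⟩
  have := card_filter_superset (n := m + 1) (b := a + 1) (S := {v}) (by simp)
  simp only [singleton_subset_iff, card_singleton, Nat.add_sub_cancel] at this
  rw [this, hca]

/-! ### Affine interpolation between the two bounds -/

section interpolation

variable {ι : Type*} {s : Finset ι} {f d c e Y : ι → ℕ} {C x X : ℕ}

/-- Since `d i ≥ x * Y i / X`, the left side is at most the convex combination of the two bounds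
with weights `x/X` and `1 - x/X`. -/
lemma sum_le_max_of_mul_le (hfd : ∀ i ∈ s, f i + d i ≤ c i) (hc : ∀ i ∈ s, e i + Y i = c i)
    (hxY : ∀ i ∈ s, x * Y i ≤ d i * X) (hx : x ≤ X) :
    C + x + ∑ i ∈ s, f i ≤ max (C + X + ∑ i ∈ s, e i) (C + ∑ i ∈ s, c i) := by
  have h1 := sum_le_sum hfd
  have h2 := sum_congr rfl hc
  have h3 := sum_le_sum hxY
  rw [sum_add_distrib] at h1 h2
  rw [← mul_sum, ← sum_mul] at h3
  have h4 := le_max_left (C + X + ∑ i ∈ s, e i) (C + ∑ i ∈ s, c i)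
  have h5 := le_max_right (C + X + ∑ i ∈ s, e i) (C + ∑ i ∈ s, c i)
  generalize max (C + X + ∑ i ∈ s, e i) (C + ∑ i ∈ s, c i) = M at *
  rcases Nat.eq_zero_or_pos X with rfl | hX
  · omega
  obtain ⟨z, rfl⟩ := Nat.exists_eq_add_of_le hx
  have h6 := Nat.mul_le_mul_left x h4
  have h7 := Nat.mul_le_mul_left z h5
  have h8 := Nat.mul_le_mul_left (x + z) h1
  refine le_of_mul_le_mul_left (a := x + z) ?_ hX
  rw [← h2] at h7 h8
  nlinarith

lemma eq_cases_of_sum_eq_max (hfd : ∀ i ∈ s, f i + d i ≤ c i) (hc : ∀ i ∈ s, e i + Y i = c i)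
    (hxY : ∀ i ∈ s, x * Y i ≤ d i * X) (hx : x ≤ X)
    (heq : C + x + ∑ i ∈ s, f i = max (C + X + ∑ i ∈ s, e i) (C + ∑ i ∈ s, c i)) :
    (x = 0 ∧ C + X + ∑ i ∈ s, e i ≤ C + ∑ i ∈ s, c i ∧ ∀ i ∈ s, f i = c i) ∨
    (x = X ∧ C + ∑ i ∈ s, c i ≤ C + X + ∑ i ∈ s, e i ∧ ∀ i ∈ s, f i = e i) ∨
    (0 < x ∧ x < X ∧ ∀ i ∈ s, x * Y i = d i * X) := by
  have h4 := le_max_left (C + X + ∑ i ∈ s, e i) (C + ∑ i ∈ s, c i)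
  have h5 := le_max_right (C + X + ∑ i ∈ s, e i) (C + ∑ i ∈ s, c i)
  rw [← heq] at h4 h5
  rcases Nat.eq_zero_or_pos x with rfl | hx0
  · have hle : ∀ i ∈ s, f i ≤ c i := fun i hi => by have := hfd i hi; omega
    have h1 := sum_le_sum hle
    exact Or.inl ⟨rfl, by omega, (sum_eq_sum_iff_of_le hle).1 (by omega)⟩
  rcases hx.eq_or_lt with rfl | hlt
  · have hle : ∀ i ∈ s, f i ≤ e i := fun i hi => by
      have h1 := hfd i hi
      have h2 := hc i hi
      have h3 := hxY i hi
      rw [mul_comm] at h3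
      have := Nat.le_of_mul_le_mul_right h3 hx0
      omega
    have h1 := sum_le_sum hle
    exact Or.inr (Or.inl ⟨rfl, by omega, (sum_eq_sum_iff_of_le hle).1 (by omega)⟩)
  refine Or.inr (Or.inr ⟨hx0, hlt, (sum_eq_sum_iff_of_le hxY).1 ?_⟩)
  have h1 := sum_le_sum hfd
  have h2 := sum_congr rfl hc
  have h3 := sum_le_sum hxY
  refine le_antisymm h3 ?_
  rw [sum_add_distrib] at h1 h2
  rw [← mul_sum, ← sum_mul]
  obtain ⟨z, rfl⟩ := Nat.exists_eq_add_of_le hx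
  have h6 := Nat.mul_le_mul_left x h4
  have h7 := Nat.mul_le_mul_left z h5
  have h8 := Nat.mul_le_mul_left (x + z) h1
  rw [← h2] at h7 h8
  nlinarith

end interpolation

/-! ### The two bounds in terms of `avoidCount` -/

section bounds

variable {r n : ℕ} {k : Fin r → ℕ} {istar : Fin r} {kbar : ℕ}

lemma boundOne_eq_add (n : ℕ) (k : Fin r → ℕ) (istar : Fin r) :
    boundOne n k = (n - 1).choose (k istar - 1) +
      ∑ i ∈ univ.erase istar, (n - 1).choose (k i - 1) :=
  (add_sum_erase _ _ (mem_univ istar)).symm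

/-- The `a`-sets meeting a `t`-set `T` are those through a fixed point of `T`, plus those whose
complement contains this point but not all of `T`. -/
lemma choose_sub_choose_eq_add {a t : ℕ} (ha : 1 ≤ a) (ht : 1 ≤ t) (hat : a + t ≤ n) :
    n.choose a - (n - t).choose a =
      (n - 1).choose (a - 1) + avoidCount (n - 1) (n - 1 - a) (t - 1) := by
  have h1 := avoidCount_add (N := n - 1) (r := n - 1 - a) (τ := t - 1) (by omega) (by omega)
  have h2 : (n - 1).choose (n - 1 - a) = (n - 1).choose a := Nat.choose_symm (by omega)
  have h3 : (n - t).choose (n - t - a) = (n - t).choose a := Nat.choose_symm (by omega)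
  rw [show n - 1 - (t - 1) = n - t by omega, show n - 1 - a - (t - 1) = n - t - a by omega,
    h2, h3] at h1
  obtain ⟨m, rfl⟩ : ∃ s, n = s + 1 := ⟨n - 1, by omega⟩
  obtain ⟨a, rfl⟩ : ∃ s, a = s + 1 := ⟨a - 1, by omega⟩
  have h4 := Nat.choose_succ_succ' m a
  simp only [Nat.add_sub_cancel] at *
  omega

lemma choose_add_avoidCount {b t : ℕ} (ht : 1 ≤ t) (htb : t ≤ b) (hb : b ≤ n) :
    (n - t).choose (b - t) + avoidCount (n - 1) (b - 1) (t - 1) = (n - 1).choose (b - 1) := by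
  have h1 := avoidCount_add (N := n - 1) (r := b - 1) (τ := t - 1) (by omega) (by omega)
  rw [show n - 1 - (t - 1) = n - t by omega, show b - 1 - (t - 1) = b - t by omega] at h1
  omega

lemma boundMin_one (hk : ∀ i, 1 ≤ k i) (hn : k istar + 1 ≤ n) :
    boundMin n k istar 1 = boundOne n k := by
  rw [boundMin, boundOne_eq_add n k istar, choose_sub_choose_eq_add (hk istar) le_rfl hn]
  simp

end bounds

/-! ### Upper bound and extremal families away from the boundary -/

section families

variable {r n : ℕ} {k : Fin r → ℕ} {F : Fin r → Finset (Finset (Fin n))} {istar : Fin r}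
  {kbar : ℕ}

lemma inter_nonempty (hcross : CrossIntersecting F) {i j : Fin r}
    (hij : i ≠ j) : ∀ A ∈ F i, ∀ B ∈ F j, (A ∩ B).Nonempty := by
  intro A hA B hB
  rcases lt_or_gt_of_ne hij with h | h
  · exact hcross i j h A hA B hB
  · rw [inter_comm]
    exact hcross j i h B hB A hA

lemma sum_card_eq_boundMin {S : Finset (Fin n)} (hS : ∀ i, i ≠ istar → S.card ≤ k i)
    (hstar : F istar = (kSubsets n (k istar)).filter (fun A => (A ∩ S).Nonempty))
    (hF : ∀ i, i ≠ istar → F i = (kSubsets n (k i)).filter (fun A => S ⊆ A)) :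
    ∑ i, (F i).card = boundMin n k istar S.card := by
  rw [← add_sum_erase _ _ (mem_univ istar), boundMin, hstar]
  congr 1
  · have := card_filter_inter_nonempty (a := k istar) S
    omega
  · refine sum_congr rfl fun i hi => ?_
    rw [hF i (ne_of_mem_erase hi), card_filter_superset (hS i (ne_of_mem_erase hi))]

/-- If `𝒜` is the family of all `a`-element sets that meet `S`, then a family that is
cross-intersecting with it and has the right size is the family of all sets that contain `S`. -/
lemma eq_filter_superset {a b : ℕ} {𝒜 ℬ : Finset (Finset (Fin n))} {S : Finset (Fin n)}
    (ha : 1 ≤ a) (hab : b + a ≤ n) (hSb : S.card ≤ b) (hℬ : ℬ ⊆ kSubsets n b)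
    (h𝒜 : 𝒜 = (kSubsets n a).filter (fun A => (A ∩ S).Nonempty))
    (hcross : ∀ A ∈ 𝒜, ∀ B ∈ ℬ, (A ∩ B).Nonempty)
    (hcard : ℬ.card = (n - S.card).choose (b - S.card)) :
    ℬ = (kSubsets n b).filter (fun B => S ⊆ B) := by
  refine eq_of_subset_of_card_le (fun B hB => mem_filter.2 ⟨hℬ hB, ?_⟩) ?_
  · refine subset_of_forall_inter_nonempty ha ?_ fun A hA hAS => hcross A ?_ B hB
    · rw [mem_kSubsets.1 (hℬ hB)]
      exact hab
    · rw [h𝒜, mem_filter, mem_kSubsets]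
      exact ⟨hA, hAS⟩
  · rw [card_filter_superset hSb, hcard]

lemma subset_filter_inter_nonempty {a : ℕ} {𝒜 ℬ : Finset (Finset (Fin n))} {S : Finset (Fin n)}
    (h𝒜 : 𝒜 ⊆ kSubsets n a) (hS : S ∈ ℬ) (hcross : ∀ A ∈ 𝒜, ∀ B ∈ ℬ, (A ∩ B).Nonempty) :
    𝒜 ⊆ (kSubsets n a).filter (fun A => (A ∩ S).Nonempty) := fun A hA =>
  mem_filter.2 ⟨h𝒜 hA, hcross A hA S hS⟩

/-- The upper bound, and the structure of the families that attain it away from the boundary. -/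
lemma sum_card_le_and_eq (hk : ∀ i, 1 ≤ k i) (hF : ∀ i, F i ⊆ kSubsets n (k i))
    (hne : ∀ i, (F i).Nonempty) (hcross : CrossIntersecting F)
    (hstar : (n - 1).choose (k istar - 1) ≤ (F istar).card)
    (hkbar : IsLeast (k '' {i | i ≠ istar}) kbar) (hn : ∀ i, i ≠ istar → k i + k istar ≤ n) :
    (∑ i, (F i).card ≤ max (boundMin n k istar kbar) (boundOne n k)) ∧
    (kbar + k istar < n →
      ∑ i, (F i).card = max (boundMin n k istar kbar) (boundOne n k) →
        ∃ S : Finset (Fin n),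
          ((S.card = 1 ∧ boundMin n k istar kbar ≤ boundOne n k) ∨
            (S.card = kbar ∧ boundOne n k ≤ boundMin n k istar kbar)) ∧
          F istar = (kSubsets n (k istar)).filter (fun A => (A ∩ S).Nonempty) ∧
          ∀ i, i ≠ istar → F i = (kSubsets n (k i)).filter (fun A => S ⊆ A)) := by
  obtain ⟨⟨j, hj, rfl⟩, hmin⟩ := hkbar
  replace hj : j ≠ istar := hj
  replace hmin : ∀ i, i ≠ istar → k j ≤ k i := fun i hi => hmin ⟨i, hi, rfl⟩
  have hks := hk istar
  have hkj := hk j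
  have hnj := hn j hj
  have hint i (hi : i ≠ istar) := hcross.inter_nonempty hi.symm
  obtain ⟨x, hx⟩ := Nat.exists_eq_add_of_le hstar
  set C := (n - 1).choose (k istar - 1) with hC
  set X := avoidCount (n - 1) (n - 1 - k istar) (k j - 1) with hX
  have hCX : n.choose (k istar) - (n - k j).choose (k istar) = C + X :=
    choose_sub_choose_eq_add hks hkj (by omega)
  -- Every member of `F istar` meets a fixed `S ∈ F j`, and `S` has the least size `k j`.
  have hxX : x ≤ X := by
    obtain ⟨S, hS⟩ := hne j
    have h1 := card_le_card (subset_filter_inter_nonempty (hF istar) hS (hint j hj))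
    have h2 := card_filter_inter_nonempty (a := k istar) S
    rw [mem_kSubsets.1 (hF j hS)] at h2
    omega
  have hex : ∀ i, i ≠ istar → ∃ d, (F i).card + d ≤ (n - 1).choose (k i - 1) ∧
      x * avoidCount (n - 1) (k i - 1) (k j - 1) ≤ d * X ∧
      (k i + k istar < n → 0 < x → x < X →
        x * avoidCount (n - 1) (k i - 1) (k j - 1) < d * X) := by
    intro i hi
    have h1 := hk i
    have h2 := hn i hi
    have h3 := hmin i hi
    have h4 := hint i hi
    have h5 := hF i
    have h6 := hF istar
    rw [hX] at hxX ⊢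
    generalize F i = ℬ at *
    generalize F istar = 𝒜 at *
    obtain ⟨m, rfl⟩ : ∃ s, n = s + 1 := ⟨n - 1, by omega⟩
    obtain ⟨a, ha⟩ : ∃ s, k istar = s + 1 := ⟨k istar - 1, by omega⟩
    obtain ⟨b, hb⟩ : ∃ s, k i = s + 1 := ⟨k i - 1, by omega⟩
    rw [ha] at h2 h6 hxX hC ⊢
    rw [hb] at h2 h5 h3 ⊢
    simp only [Nat.add_sub_cancel] at *
    obtain ⟨d, hd1, hd2, hd3⟩ := exists_card_add_le (τ := k j - 1) h6 h5 h4 (by omega) (by omega)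
      (hC ▸ hx) hxX
    exact ⟨d, hd1, hd2, fun h => hd3 (by omega)⟩
  choose! d hd1 hd2 hd3 using hex
  have hMin : boundMin n k istar (k j) =
      C + X + ∑ i ∈ univ.erase istar, (n - k j).choose (k i - k j) := by
    rw [boundMin, hCX]
  have hfd : ∀ i ∈ univ.erase istar, (F i).card + d i ≤ (n - 1).choose (k i - 1) :=
    fun i hi => hd1 i (ne_of_mem_erase hi)
  have hxY : ∀ i ∈ univ.erase istar, x * avoidCount (n - 1) (k i - 1) (k j - 1) ≤ d i * X :=
    fun i hi => hd2 i (ne_of_mem_erase hi)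
  have hc : ∀ i ∈ univ.erase istar, (n - k j).choose (k i - k j) +
      avoidCount (n - 1) (k i - 1) (k j - 1) = (n - 1).choose (k i - 1) := fun i hi =>
    choose_add_avoidCount hkj (hmin i (ne_of_mem_erase hi))
      (by have := hn i (ne_of_mem_erase hi); omega)
  rw [hMin, boundOne_eq_add n k istar, ← add_sum_erase _ _ (mem_univ istar), hx]
  refine ⟨sum_le_max_of_mul_le hfd hc hxY hxX, fun hlt heq => ?_⟩
  rcases eq_cases_of_sum_eq_max hfd hc hxY hxX heq with
    ⟨rfl, hle, hf⟩ | ⟨rfl, hle, hf⟩ | ⟨h0, hltX, hf⟩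
  · obtain ⟨y, hy⟩ := exists_eq_star hks hkj (hF istar) (hF j) (hint j hj) (by omega)
      (by omega) (hf j (mem_erase.2 ⟨hj, mem_univ j⟩))
    rw [← filter_inter_singleton] at hy
    refine ⟨{y}, Or.inl ⟨card_singleton y, hle⟩, hy, fun i hi => ?_⟩
    refine eq_filter_superset hks (hn i hi) (by simpa using hk i) (hF i) hy (hint i hi) ?_
    rw [card_singleton]
    exact hf i (mem_erase.2 ⟨hi, mem_univ i⟩)
  · have h1 : (F j).card = 1 := by simpa using hf j (mem_erase.2 ⟨hj, mem_univ j⟩)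
    obtain ⟨S, hS⟩ := card_pos.1 (h1 ▸ one_pos : 0 < (F j).card)
    have hSc := mem_kSubsets.1 (hF j hS)
    have hst : F istar = (kSubsets n (k istar)).filter (fun A => (A ∩ S).Nonempty) := by
      refine eq_of_subset_of_card_le
        (subset_filter_inter_nonempty (hF istar) hS (hint j hj)) ?_
      have h2 := card_filter_inter_nonempty (a := k istar) S
      rw [hSc] at h2
      omega
    refine ⟨S, Or.inr ⟨hSc, hle⟩, hst, fun i hi => ?_⟩
    refine eq_filter_superset hks (hn i hi) (hSc ▸ hmin i hi) (hF i) hst (hint i hi) ?_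
    rw [hSc]
    exact hf i (mem_erase.2 ⟨hi, mem_univ i⟩)
  -- The index `j` is the one for which `k j + k istar < n` is known, so there the ratio bound is
  -- strict.
  · exact absurd (hf j (mem_erase.2 ⟨hj, mem_univ j⟩)) (hd3 j hj hlt h0 hltX).ne

end families

/-! ### The boundary case, where complementation matches the levels -/

section boundary

variable {n a b : ℕ} {𝒜 𝓕 𝓖 : Finset (Finset (Fin n))}

lemma complFamily_eq_compls : complFamily 𝓕 = 𝓕ᶜˢ := by
  rw [complFamily, ← Finset.image_compl]
  rfl

lemma complFamily_subset (h𝓕 : 𝓕 ⊆ kSubsets n b) (hab : n = b + a) :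
    complFamily 𝓕 ⊆ kSubsets n a := by
  rw [complFamily_eq_compls]
  intro S hS
  rw [mem_kSubsets, sized_compls h𝓕 (mem_coe.2 hS)]
  omega

lemma card_sdiff_complFamily (h𝓕 : 𝓕 ⊆ kSubsets n b) (hab : n = b + a) :
    (kSubsets n a \ complFamily 𝓕).card + 𝓕.card = n.choose a := by
  have h := card_sdiff_add_card_eq_card (complFamily_subset h𝓕 hab)
  rwa [card_kSubsets, complFamily_eq_compls, card_compls, ← complFamily_eq_compls] at h

lemma subset_sdiff_complFamily (h𝒜 : 𝒜 ⊆ kSubsets n a)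
    (hcross : ∀ A ∈ 𝒜, ∀ B ∈ 𝓕, (A ∩ B).Nonempty) : 𝒜 ⊆ kSubsets n a \ complFamily 𝓕 := by
  intro A hA
  rw [mem_sdiff, complFamily_eq_compls, mem_compls]
  refine ⟨h𝒜 hA, fun h => ?_⟩
  obtain ⟨x, hx⟩ := hcross A hA _ h
  simp at hx

lemma eq_of_sdiff_complFamily_eq (h𝓕 : 𝓕 ⊆ kSubsets n b) (h𝓖 : 𝓖 ⊆ kSubsets n b)
    (hab : n = b + a) (h : kSubsets n a \ complFamily 𝓕 = kSubsets n a \ complFamily 𝓖) :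
    𝓕 = 𝓖 := by
  have h1 : complFamily 𝓕 = complFamily 𝓖 := by
    rw [← Finset.sdiff_sdiff_eq_self (complFamily_subset h𝓕 hab), h,
      Finset.sdiff_sdiff_eq_self (complFamily_subset h𝓖 hab)]
  rw [complFamily_eq_compls, complFamily_eq_compls] at h1
  rw [← compls_compls 𝓕, h1, compls_compls]

lemma sdiff_complFamily_star (hab : n = b + a) (x : Fin n) :
    kSubsets n a \ complFamily ((kSubsets n b).filter fun A => x ∈ A) =
      (kSubsets n a).filter fun A => x ∈ A := by
  ext A
  rw [mem_sdiff, complFamily_eq_compls, mem_compls, mem_filter, mem_filter, mem_compl,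
    mem_kSubsets, mem_kSubsets, card_compl, Fintype.card_fin]
  refine and_congr_right fun h => ?_
  rw [h, not_and, not_not]
  exact ⟨fun h' => h' (by omega), fun h' _ => h'⟩

variable {r : ℕ} {k : Fin r → ℕ} {F : Fin r → Finset (Finset (Fin n))} {istar : Fin r}
  {kbar : ℕ}

lemma choose_sub_one_add (ha : 1 ≤ a) (hb : 1 ≤ b) (hab : n = b + a) :
    (n - 1).choose (a - 1) + (n - 1).choose (b - 1) = n.choose a := by
  obtain ⟨a, rfl⟩ : ∃ s, a = s + 1 := ⟨a - 1, by omega⟩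
  obtain ⟨b, rfl⟩ : ∃ s, b = s + 1 := ⟨b - 1, by omega⟩
  subst hab
  have h : (b + 1 + (a + 1) - 1).choose b = (b + 1 + (a + 1) - 1).choose (a + 1) :=
    Nat.choose_symm_of_eq_add (by omega)
  simp only [Nat.add_sub_cancel]
  rw [h, show b + 1 + (a + 1) = (b + 1 + (a + 1) - 1) + 1 by omega, Nat.choose_succ_succ',
    Nat.add_sub_cancel]

/-- Here `boundMin` is `C(n, k istar) - 1 + (r - 1)`, which never exceeds `boundOne`. -/
lemma max_bound_eq (hr : 2 ≤ r) (hks : 1 ≤ k istar) (hkb : 1 ≤ kbar)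
    (hk : ∀ i, i ≠ istar → k i = kbar) (hn : n = kbar + k istar) :
    max (boundMin n k istar kbar) (boundOne n k) =
      n.choose (k istar) + (r - 2) * (n - 1).choose (kbar - 1) := by
  have h1 := choose_sub_one_add hks hkb hn
  have hpos : 0 < (n - 1).choose (kbar - 1) := Nat.choose_pos (by omega)
  have hcard : (univ.erase istar : Finset (Fin r)).card = r - 2 + 1 := by
    rw [card_erase_of_mem (mem_univ _), card_univ, Fintype.card_fin]
    omega
  have hOne : boundOne n k = n.choose (k istar) + (r - 2) * (n - 1).choose (kbar - 1) := by
    rw [boundOne_eq_add n k istar,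
      sum_congr rfl fun i hi => by rw [hk i (ne_of_mem_erase hi)], sum_const, hcard, ← h1,
      smul_eq_mul]
    ring
  rw [hOne, max_eq_right]
  rw [boundMin, sum_congr rfl fun i hi => by rw [hk i (ne_of_mem_erase hi)], sum_const, hcard,
    show n - kbar = k istar by omega]
  simp only [Nat.choose_self, Nat.sub_self, Nat.choose_zero_right, smul_eq_mul, mul_one]
  have h2 : 0 < n.choose (k istar) := Nat.choose_pos (by omega)
  have h3 := Nat.le_mul_of_pos_right (r - 2) hpos
  omega

lemma sum_card_eq_iff_of_two (hr : r = 2) (hks : 1 ≤ k istar) (hkb : 1 ≤ kbar)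
    (hF : ∀ i, F i ⊆ kSubsets n (k i)) (hne : ∀ i, (F i).Nonempty) (hcross : CrossIntersecting F)
    (hstar : (n - 1).choose (k istar - 1) ≤ (F istar).card)
    (hk : ∀ i, i ≠ istar → k i = kbar) (hn : n = kbar + k istar) :
    (∑ i, (F i).card = max (boundMin n k istar kbar) (boundOne n k) ↔
      ∀ i, i ≠ istar → F istar = kSubsets n (k istar) \ complFamily (F i) ∧
        1 ≤ (F i).card ∧ (F i).card ≤ (n - 1).choose (kbar - 1)) := by
  subst hr
  rw [max_bound_eq le_rfl hks hkb hk hn, ← add_sum_erase _ _ (mem_univ istar)]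
  have h1 := choose_sub_one_add hks hkb hn
  obtain ⟨j, hj⟩ : ∃ j, univ.erase istar = {j} := by
    rw [← card_eq_one, card_erase_of_mem (mem_univ _), card_univ, Fintype.card_fin]
  have hji : j ≠ istar := ne_of_mem_erase (hj ▸ mem_singleton_self j)
  have hij i (hi : i ≠ istar) : i = j := by
    rw [← mem_singleton, ← hj]
    exact mem_erase.2 ⟨hi, mem_univ i⟩
  have hFj : F j ⊆ kSubsets n kbar := hk j hji ▸ hF j
  have h2 := card_sdiff_complFamily hFj hn
  rw [hj, sum_singleton, Nat.sub_self, zero_mul, add_zero]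
  constructor
  · intro h i hi
    rw [hij i hi]
    refine ⟨eq_of_subset_of_card_le (subset_sdiff_complFamily (hF istar)
      (hcross.inter_nonempty hji.symm)) (by omega), card_pos.2 (hne j), by omega⟩
  · intro h
    rw [(h j hji).1, h2]

/-- Each `F i` together with `F istar` has at most `C(n, k istar)` members, and `hstar` bounds each
of the other `r - 2` families by `C(n-1,kbar-1)`. Equality makes every pair tight, so each `F i` is
determined by `F istar`; the common family is intersecting because it occurs at two distinct
indices. -/
lemma sum_card_eq_iff_of_two_lt (hr : 2 < r) (hks : 1 ≤ k istar) (hkb : 1 ≤ kbar)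
    (hF : ∀ i, F i ⊆ kSubsets n (k i)) (hcross : CrossIntersecting F)
    (hstar : (n - 1).choose (k istar - 1) ≤ (F istar).card)
    (hk : ∀ i, i ≠ istar → k i = kbar) (hn : n = kbar + k istar) :
    (∑ i, (F i).card = max (boundMin n k istar kbar) (boundOne n k) ↔
        ∃ 𝓕 : Finset (Finset (Fin n)),
          𝓕 ⊆ kSubsets n kbar ∧
          (∀ A ∈ 𝓕, ∀ B ∈ 𝓕, (A ∩ B).Nonempty) ∧
          𝓕.card = (n - 1).choose (kbar - 1) ∧
          (∀ i, i ≠ istar → F i = 𝓕) ∧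
          F istar = kSubsets n (k istar) \ complFamily 𝓕) := by
  rw [max_bound_eq hr.le hks hkb hk hn, ← add_sum_erase _ _ (mem_univ istar)]
  have h1 := choose_sub_one_add hks hkb hn
  have hcard : (univ.erase istar : Finset (Fin r)).card = r - 2 + 1 := by
    rw [card_erase_of_mem (mem_univ _), card_univ, Fintype.card_fin]
    omega
  have hFi i (hi : i ≠ istar) : F i ⊆ kSubsets n kbar := hk i hi ▸ hF i
  have hsub i (hi : i ≠ istar) : F istar ⊆ kSubsets n (k istar) \ complFamily (F i) :=
    subset_sdiff_complFamily (hF istar) (hcross.inter_nonempty hi.symm)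
  have hle i (hi : i ≠ istar) : (F istar).card + (F i).card ≤ n.choose (k istar) := by
    rw [← card_sdiff_complFamily (hFi i hi) hn]
    exact Nat.add_le_add_right (card_le_card (hsub i hi)) _
  constructor
  · intro h
    have heq : ∀ i, i ≠ istar → (F istar).card + (F i).card = n.choose (k istar) := by
      intro i hi
      have hi' : i ∈ univ.erase istar := mem_erase.2 ⟨hi, mem_univ i⟩
      have h2 : ∑ l ∈ (univ.erase istar).erase i, (F l).card ≤
          (r - 2) * (n - 1).choose (kbar - 1) := by
        refine (sum_le_card_nsmul _ _ ((n - 1).choose (kbar - 1)) fun l hl => ?_).trans ?_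
        · have := hle l (ne_of_mem_erase (mem_of_mem_erase hl))
          omega
        · rw [card_erase_of_mem hi', hcard, Nat.add_sub_cancel, smul_eq_mul]
      rw [← add_sum_erase _ _ hi'] at h
      have := hle i hi
      omega
    obtain ⟨i, hi⟩ : (univ.erase istar).Nonempty := card_pos.1 (by omega)
    have hi := ne_of_mem_erase hi
    have hall l (hl : l ≠ istar) : F istar = kSubsets n (k istar) \ complFamily (F l) := by
      refine eq_of_subset_of_card_le (hsub l hl) ?_
      have h2 := card_sdiff_complFamily (hFi l hl) hn
      have h3 := heq l hl
      omega
    have hsame l (hl : l ≠ istar) : F l = F i :=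
      eq_of_sdiff_complFamily_eq (hFi l hl) (hFi i hi) hn ((hall l hl).symm.trans (hall i hi))
    refine ⟨F i, hFi i hi, ?_, ?_, hsame, hall i hi⟩
    · obtain ⟨l, hl⟩ : ((univ.erase istar).erase i).Nonempty := by
        refine card_pos.1 ?_
        rw [card_erase_of_mem (mem_erase.2 ⟨hi, mem_univ i⟩)]
        omega
      have hl' := hcross.inter_nonempty (ne_of_mem_erase hl)
      rwa [hsame l (ne_of_mem_erase (mem_of_mem_erase hl))] at hl'
    · rw [sum_congr rfl fun l hl => by rw [hsame l (ne_of_mem_erase hl)], sum_const, hcard,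
        smul_eq_mul, add_mul, one_mul] at h
      have h3 := heq i hi
      exact Nat.eq_of_mul_eq_mul_left (show 0 < r - 2 by omega) (by omega)
  · rintro ⟨𝓕, h𝓕, -, hc, hall, hst⟩
    have h2 := card_sdiff_complFamily h𝓕 hn
    rw [hst, sum_congr rfl fun l hl => by rw [hall l (ne_of_mem_erase hl)], sum_const, hcard,
      smul_eq_mul, hc, add_mul, one_mul]
    omega

/-- For `2 * kbar < n` an intersecting family of star size is a star: `exists_eq_star` applies to
the family paired with itself. -/
lemma exists_intersecting_iff_exists_star (hkb : 1 ≤ kbar)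
    (h2 : 2 * kbar < n) (hn : n = kbar + k istar) :
    (∃ 𝓕 : Finset (Finset (Fin n)),
          𝓕 ⊆ kSubsets n kbar ∧
          (∀ A ∈ 𝓕, ∀ B ∈ 𝓕, (A ∩ B).Nonempty) ∧
          𝓕.card = (n - 1).choose (kbar - 1) ∧
          (∀ i, i ≠ istar → F i = 𝓕) ∧
          F istar = kSubsets n (k istar) \ complFamily 𝓕) ↔
      ∃ x : Fin n,
          F istar = (kSubsets n (k istar)).filter (fun A => x ∈ A) ∧
          ∀ i, i ≠ istar → F i = (kSubsets n kbar).filter (fun A => x ∈ A) := by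
  constructor
  · rintro ⟨𝓕, h𝓕, hint, hc, hall, hst⟩
    obtain ⟨x, rfl⟩ := exists_eq_star hkb hkb h𝓕 h𝓕 hint (by omega) hc hc
    exact ⟨x, hst.trans (sdiff_complFamily_star hn x), hall⟩
  · rintro ⟨x, hst, hall⟩
    refine ⟨_, filter_subset _ _, ?_, ?_, hall, hst.trans (sdiff_complFamily_star hn x).symm⟩
    · intro A hA B hB
      exact ⟨x, mem_inter.2 ⟨(mem_filter.1 hA).2, (mem_filter.1 hB).2⟩⟩
    · simpa using card_filter_superset (S := {x}) (b := kbar) (by simpa using hkb)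

end boundary

end CrossIntersecting

/-! ### The theorem -/

theorem theorem1p6 (r n : ℕ) (hr : 2 ≤ r) (k : Fin r → ℕ) (hk : ∀ i, 1 ≤ k i)
    (F : Fin r → Finset (Finset (Fin n)))
    (hF : ∀ i, F i ⊆ kSubsets n (k i))
    (hne : ∀ i, (F i).Nonempty)
    (hcross : CrossIntersecting F)
    (istar : Fin r)
    (hstar : (n - 1).choose (k istar - 1) ≤ (F istar).card)
    (kbar : ℕ) (hkbar : IsLeast (k '' {i | i ≠ istar}) kbar)
    (hn : ∀ i, i ≠ istar → k i + k istar ≤ n) :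
    -- the upper bound
    (∑ i, (F i).card ≤ max (boundMin n k istar kbar) (boundOne n k)) ∧
    -- equality, boundary case, two families
    (n = kbar + k istar → r = 2 →
      (∑ i, (F i).card = max (boundMin n k istar kbar) (boundOne n k) ↔
        ∀ i, i ≠ istar →
          F istar = kSubsets n (k istar) \ complFamily (F i) ∧
          1 ≤ (F i).card ∧ (F i).card ≤ (n - 1).choose (kbar - 1))) ∧
    -- equality, boundary case, more than two families, `n > 2 k̄`
    (n = kbar + k istar → 2 < r → 2 * kbar < n →
      (∑ i, (F i).card = max (boundMin n k istar kbar) (boundOne n k) ↔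
        ∃ x : Fin n,
          F istar = (kSubsets n (k istar)).filter (fun A => x ∈ A) ∧
          ∀ i, i ≠ istar → F i = (kSubsets n kbar).filter (fun A => x ∈ A))) ∧
    -- equality, boundary case, more than two families, `n ≤ 2 k̄`
    (n = kbar + k istar → 2 < r → n ≤ 2 * kbar →
      (∑ i, (F i).card = max (boundMin n k istar kbar) (boundOne n k) ↔
        ∃ 𝓕 : Finset (Finset (Fin n)),
          𝓕 ⊆ kSubsets n kbar ∧
          (∀ A ∈ 𝓕, ∀ B ∈ 𝓕, (A ∩ B).Nonempty) ∧
          𝓕.card = (n - 1).choose (kbar - 1) ∧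
          (∀ i, i ≠ istar → F i = 𝓕) ∧
          F istar = kSubsets n (k istar) \ complFamily 𝓕)) ∧
    -- equality, `n > k̄ + k_{i*}`; the size of `S` is the one (or both) of `1` and `k̄` whose value
    -- attains the maximum
    (kbar + k istar < n →
      (∑ i, (F i).card = max (boundMin n k istar kbar) (boundOne n k) ↔
        ∃ S : Finset (Fin n),
          ((S.card = 1 ∧ boundMin n k istar kbar ≤ boundOne n k) ∨
            (S.card = kbar ∧ boundOne n k ≤ boundMin n k istar kbar)) ∧
          F istar = (kSubsets n (k istar)).filter (fun A => (A ∩ S).Nonempty) ∧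
          ∀ i, i ≠ istar → F i = (kSubsets n (k i)).filter (fun A => S ⊆ A))) := by
  have hkb : 1 ≤ kbar := by
    obtain ⟨⟨j, -, rfl⟩, -⟩ := hkbar
    exact hk j
  have hmin : ∀ i, i ≠ istar → kbar ≤ k i := fun i hi => hkbar.2 ⟨i, hi, rfl⟩
  have hbdry (h : n = kbar + k istar) i (hi : i ≠ istar) : k i = kbar := by
    have h1 := hmin i hi
    have h2 := hn i hi
    omega
  obtain ⟨hle, heq⟩ :=
    CrossIntersecting.sum_card_le_and_eq hk hF hne hcross hstar hkbar hn
  refine ⟨hle, fun h h2 => ?_, fun h h2 h3 => ?_, fun h h2 _ => ?_, fun h => ⟨heq h, ?_⟩⟩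
  · exact CrossIntersecting.sum_card_eq_iff_of_two h2 (hk istar) hkb hF hne hcross hstar
      (hbdry h) h
  · rw [CrossIntersecting.sum_card_eq_iff_of_two_lt h2 (hk istar) hkb hF hcross hstar
      (hbdry h) h]
    exact CrossIntersecting.exists_intersecting_iff_exists_star hkb h3 h
  · exact CrossIntersecting.sum_card_eq_iff_of_two_lt h2 (hk istar) hkb hF hcross hstar
      (hbdry h) h
  · rintro ⟨S, hS, hst, hall⟩
    have hSk : ∀ i, i ≠ istar → S.card ≤ k i := by
      intro i hi
      rcases hS with ⟨h1, -⟩ | ⟨h1, -⟩ <;> rw [h1]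
      · exact hk i
      · exact hmin i hi
    -- Both constructions have total `boundMin` at the size of `S`, and `boundMin` at `1` is
    -- `boundOne`.
    rw [CrossIntersecting.sum_card_eq_boundMin hSk hst hall]
    rcases hS with ⟨h1, h2⟩ | ⟨h1, h2⟩ <;> rw [h1]
    · rw [CrossIntersecting.boundMin_one hk (by omega), max_eq_right h2]
    · rw [max_eq_left h2]
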